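/- All digraphs are finite, without loops and without parallel arcs. A digraph is strong if for all vertices $u,v$ it contains a directed walk from $u$ to $v$. For a digraph $D$ and a set $S\subseteq V(D)$ with $|S|\ge 2$, let $\kappa_S(D)$ be the maximum number $p$ of strong subgraphs $D_1,\dots,D_p$ of $D$, each containing all vertices of $S$, such that $V(D_i)\cap V(D_j)=S$ and $A(D_i)\cap A(D_j)=\emptyset$ for all $1\le i<j\le p$. For $2\le k\le |V(D)|$ let $\kappa_k(D)=\min\{\kappa_S(D) : S\subseteq V(D),\ |S|=k\}$. Let $\overleftrightarrow{K}_n$ denote the complete biorientation of $K_n$, that is, the digraph on $n$ vertices in which every ordered pair of distinct vertices is an arc. **Theorem.** Let $2\le k\le n$. For every strong digraph $D$ of order $n$, $$1\le \kappa_k(D)\le n-1 .$$ Moreover, $\kappa_k(D)=n-1$ if and only if $D\cong\overleftrightarrow{K}_n$ and $k\notin\{4,6\}$. Both bounds are sharp: for all $2\le k\le n$ there is a strong digraph $D$ of order $n$ with $\kappa_k(D)=1$, and for all $2\le k\le n$ with $k\notin\{4,6\}$ there is a strong digraph $D$ of order $n$ with $\kappa_k(D)=n-1$. -/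

import Mathlib

namespace StrongSubgraph

/-- A digraph without loops. (Parallel arcs are impossible, since arcs are given by a relation.) -/
def IsLoopless {V : Type*} (D : Digraph V) : Prop :=
  ∀ v, ¬ D.Adj v v

/-- A digraph is strong if every vertex can be reached from every vertex by a directed walk. -/
def IsStrong {V : Type*} (D : Digraph V) : Prop :=
  ∀ u v, Relation.ReflTransGen D.Adj u v

/-- The complete biorientation of an undirected graph: each edge is replaced by
the two arcs of opposite directions. -/
def biorientation {V : Type*} (G : SimpleGraph V) : Digraph V where
  Adj u v := G.Adj u v

/-- Isomorphism of digraphs: a bijection of the vertices that preserves and reflects arcs. -/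
def IsIsomorphic {V W : Type*} (D : Digraph V) (E : Digraph W) : Prop :=
  Nonempty (D.Adj ≃r E.Adj)

/-- A subgraph (subdigraph) of a digraph: a set of vertices, and a set of arcs
of the digraph with both ends among these vertices. -/
structure Subdigraph {V : Type*} (D : Digraph V) where
  /-- the vertices of the subgraph -/
  verts : Set V
  /-- the arcs of the subgraph -/
  Adj : V → V → Prop
  adj_sub : ∀ {u v : V}, Adj u v → D.Adj u v
  tail_mem : ∀ {u v : V}, Adj u v → u ∈ verts
  head_mem : ∀ {u v : V}, Adj u v → v ∈ verts

/-- A subgraph is strong if each of its vertices can be reached from each of its vertices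
by a directed walk along its own arcs. In particular a one-vertex subgraph is strong. -/
def Subdigraph.IsStrong {V : Type*} {D : Digraph V} (H : Subdigraph D) : Prop :=
  ∀ u ∈ H.verts, ∀ v ∈ H.verts, Relation.ReflTransGen H.Adj u v

/-- The subgraphs `H i` are strong, contain `S`, and are `S`-internally disjoint: any two of them
have exactly the vertices of `S` in common, and no arc. -/
structure IsInternallyDisjointFamily {V : Type*} {D : Digraph V} (S : Finset V) {p : ℕ}
    (H : Fin p → Subdigraph D) : Prop where
  strong : ∀ i, (H i).IsStrong
  subset : ∀ i, (S : Set V) ⊆ (H i).verts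
  inter_verts : ∀ i j, i ≠ j → (H i).verts ∩ (H j).verts = (S : Set V)
  arc_disjoint : ∀ i j, i ≠ j → ∀ u v, ¬ ((H i).Adj u v ∧ (H j).Adj u v)

/-- `κ_S(D)`: the maximum number of `S`-internally disjoint strong subgraphs of `D` containing `S`.
The value is taken in `ℕ∞` so that the supremum is meaningful for every `S`. -/
noncomputable def kappaSet {V : Type*} (D : Digraph V) (S : Finset V) : ℕ∞ :=
  ⨆ (p : ℕ) (_ : ∃ H : Fin p → Subdigraph D, IsInternallyDisjointFamily S H), (p : ℕ∞)

/-- `κ_k(D)`: the minimum of `κ_S(D)` over all sets `S` of exactly `k` vertices. -/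
noncomputable def kappa {V : Type*} (k : ℕ) (D : Digraph V) : ℕ∞ :=
  ⨅ (S : Finset V) (_ : S.card = k), kappaSet D S

end StrongSubgraph

namespace StrongSubgraph

open Relation Function

/-! Let n be the order of D. Each of p internally disjoint strong subgraphs contains an arc leaving
a given s in S, because |S| ≥ 2, and these arcs differ. Hence κ_S(D) is at most the out-degree of s,
which is at most n - 1. A missing arc out of u gives at most n - 2 for every S containing u, so
equality forces the complete digraph. The lower bound is witnessed by D itself.

Suppose that n - 1 subgraphs exist for some k-set S. Every s in S has exactly one out-arc in each of
them. At most n - k of them use vertices outside S, since such a vertex lies in at most one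
subgraph. The remaining k - 1 or more live on S with out-degree one, so they are arc-disjoint
Hamiltonian cycles on S (`exists_isHamiltonianFamily_of_family`). Conversely, k - 1 such cycles and
the n - k stars from outside vertices to S give n - 1 subgraphs
(`le_kappaSet_of_isHamiltonianFamily`).

What remains is Tillson's theorem: k - 1 arc-disjoint Hamiltonian directed cycles exist on k
vertices if and only if k is not 4 or 6. For odd k, Walecki's zigzag cycles serve. For even k ≥ 8, a
new vertex is inserted into Walecki's cycles on k - 1 vertices, cutting one arc of each so that the
cut arcs form a Hamiltonian path, which the new vertex closes to the last cycle. The orders 4 and 6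
are excluded by exhaustive search. -/

/-- The functional digraphs of the maps `F c` are strong and pairwise arc-disjoint. On a finite
vertex set this says that they are arc-disjoint Hamiltonian directed cycles. -/
structure IsHamiltonianFamily {C V : Type*} (F : C → V → V) : Prop where
  strong : ∀ c u v, ReflTransGen (fun a b => F c a = b) u v
  disjoint : ∀ v, Injective fun c => F c v

/-! ### Self-maps that form a single cycle, and insertion of a vertex -/

theorem reflTransGen_iterate {V : Type*} (f : V → V) (v : V) (j : ℕ) :
    ReflTransGen (fun a b => f a = b) v (f^[j] v) := by
  induction j with
  | zero => exact .refl
  | succ j ih => exact ih.tail (iterate_succ_apply' f j v).symm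

theorem exists_iterate_eq {V : Type*} {f : V → V} {u v : V}
    (h : ReflTransGen (fun a b => f a = b) u v) : ∃ j, f^[j] u = v := by
  induction h with
  | refl => exact ⟨0, rfl⟩
  | tail _ h ih =>
    obtain ⟨j, rfl⟩ := ih
    exact ⟨j + 1, by rw [iterate_succ_apply']; exact h⟩

/-- An injective self-map of a finite type is a single cycle as soon as all vertices other than
`r` are mapped to vertices of smaller rank. -/
theorem strong_of_rank {V : Type*} [Finite V] {f : V → V} (hf : Injective f) (r : V) (rank : V → ℕ)
    (h : ∀ v, v ≠ r → rank (f v) < rank v) (u v : V) :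
    ReflTransGen (fun a b => f a = b) u v := by
  have to_root : ∀ n v, rank v = n → ReflTransGen (fun a b => f a = b) v r := by
    intro n
    induction n using Nat.strong_induction_on with
    | _ n ih =>
      intro v hv
      by_cases hr : v = r
      · exact hr ▸ .refl
      · exact .head rfl (ih _ (hv ▸ h v hr) _ rfl)
  obtain ⟨j, hj⟩ := exists_iterate_eq (to_root _ v rfl)
  have hper := hf.mem_periodicPts v
  obtain ⟨q, hq, hper⟩ := hper
  refine (to_root _ u rfl).trans ?_
  -- The vertex v reaches r in j steps and returns to itself after q * j steps, so the rest of this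
  -- closed walk leads from r to v.
  have hle : j ≤ q * j := Nat.le_mul_of_pos_left j hq
  have h2 : f^[q * j - j] r = v := by
    rw [← hj, ← iterate_add_apply, Nat.sub_add_cancel hle]
    exact hper.mul_const j
  exact h2 ▸ reflTransGen_iterate f r _

/-- Insertion of a new vertex `none` in one arc of each cycle; the removed arcs form a Hamiltonian
path, and `h` is the cycle through this path and the new vertex. -/
theorem IsHamiltonianFamily.insert {C V : Type*} [DecidableEq V] {F : C → V → V}
    (hF : IsHamiltonianFamily F) {a : C → V} (ha : Injective a) {h : Option V → Option V}
    (hinj : Injective h) (hs : ∀ u v, ReflTransGen (fun a b => h a = b) u v)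
    (hc : ∀ c, h (some (a c)) = some (F c (a c)))
    (hrest : ∀ v, h (some v) = none ∨ ∃ c, a c = v) :
    ∃ G : Option C → Option V → Option V, IsHamiltonianFamily G := by
  let G : Option C → Option V → Option V
    | none, x => h x
    | some c, none => some (F c (a c))
    | some c, some v => if v = a c then none else some (F c v)
  refine ⟨G, ?_, ?_⟩
  · rintro (_ | c)
    · exact hs
    -- Every old arc survives, except that the cut arc becomes a detour through the new vertex.
    · have step : ∀ v, ReflTransGen (fun a b => G (some c) a = b) (some v) (some (F c v)) := by
        intro v
        by_cases hv : v = a c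
        · refine .head (b := none) (if_pos hv) (.single ?_)
          rw [hv]
        · exact .single (if_neg hv)
      have walk : ∀ u v, ReflTransGen (fun a b => G (some c) a = b) (some u) (some v) := by
        intro u v
        obtain ⟨j, rfl⟩ := exists_iterate_eq (hF.strong c u v)
        induction j with
        | zero => exact .refl
        | succ j ih => rw [iterate_succ_apply']; exact ih.trans (step _)
      have out : ∀ v, ReflTransGen (fun a b => G (some c) a = b) none (some v) := fun v =>
        .head (b := some (F c (a c))) rfl (walk _ v)
      have back : ∀ v, ReflTransGen (fun a b => G (some c) a = b) (some v) none := fun v =>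
        (walk v (a c)).tail (if_pos rfl)
      rintro (_ | u) (_ | v)
      · exact .refl
      · exact out v
      · exact back u
      · exact walk u v
  -- At the new vertex, agreement with `h` contradicts injectivity of `h`; at a c one value is the
  -- new vertex and the other is old. Elsewhere, `h` follows the arc cut from another old cycle or
  -- goes to the new vertex, so disjointness of the old cycles applies.
  · have key : ∀ c x, G (some c) x ≠ h x := by
      rintro c (_ | v) e
      · have e' := hinj ((hc c).trans e)
        simp at e'
      · by_cases hv : v = a c
        · subst hv
          rw [hc] at e
          simp [G] at e
        · simp only [G, if_neg hv] at e
          rcases hrest v with h0 | ⟨c', rfl⟩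
          · simp [h0] at e
          · rw [hc] at e
            exact hv (congrArg a (hF.disjoint _ (Option.some.inj e))).symm
    rintro x (_ | c) (_ | d) e
    · rfl
    · exact absurd e.symm (key d x)
    · exact absurd e (key c x)
    · congr 1
      rcases x with _ | v
      · have e' : some (F c (a c)) = some (F d (a d)) := e
        rw [← hc, ← hc] at e'
        exact ha (Option.some.inj (hinj e'))
      · simp only [G] at e
        split_ifs at e with h1 h2
        · exact ha (h1.symm.trans h2)
        · exact hF.disjoint v (Option.some.inj e)

theorem IsHamiltonianFamily.transport {C V C' V' : Type*} {F : C → V → V}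
    (hF : IsHamiltonianFamily F) (i : C' ↪ C) (e : V ≃ V') :
    IsHamiltonianFamily fun c v => e (F (i c) (e.symm v)) where
  strong c u v := by
    have := ReflTransGen.lift (p := fun a b => e (F (i c) (e.symm a)) = b) e
      (by rintro a b rfl; simp [onFun]) _ _ (hF.strong (i c) (e.symm u) (e.symm v))
    simpa [onFun] using this
  disjoint v c d h := i.injective (hF.disjoint _ (e.injective h))

theorem strong_add_one (n : ℕ) [NeZero n] (u v : Fin n) :
    ReflTransGen (fun a b => a + 1 = b) u v := by
  refine strong_of_rank (f := fun a : Fin n => a + 1) (add_left_injective 1) 0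
    (fun v => if v = 0 then 0 else n - v) ?_ u v
  intro v hv
  have hv' : (v : ℕ) ≠ 0 := fun h => hv (Fin.ext (by simpa using h))
  have hlt := v.isLt
  simp only [if_neg hv]
  split_ifs with h
  · omega
  · have h' : ((v + 1 : Fin n) : ℕ) ≠ 0 := fun h0 => h (Fin.ext (by simpa using h0))
    rw [Fin.val_add] at h' ⊢
    rcases Nat.lt_or_ge 1 n with h1 | h1
    · have : ((1 : Fin n) : ℕ) = 1 := by rw [Fin.val_one', Nat.mod_eq_of_lt h1]
      rw [this] at h' ⊢
      have h2 : (v : ℕ) + 1 < n := by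
        by_contra h3
        have : (v : ℕ) + 1 = n := by omega
        simp [this] at h'
      rw [Nat.mod_eq_of_lt h2]
      omega
    · omega

/-! ### Walecki's cycles for odd order -/

/-- The position of `x` relative to `c` in `ℤ/2m`, with representatives below `2m`. -/
def relPos (m c x : ℕ) : ℕ := if c ≤ x then x - c else x + 2 * m - c

/-- The successor of `t ≠ m` in the zigzag `0, 1, -1, 2, -2, …, m` modulo `2m`. -/
def zigzag (m t : ℕ) : ℕ := if t = 0 then 1 else if t < m then 2 * m - t else 2 * m + 1 - t

/-- Translation by `c` of a representative `u` modulo `2m`. -/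
def addPos (m c u : ℕ) : ℕ := if u + c < 2 * m then u + c else u + c - 2 * m

/-- The successor of `x` in Walecki's cycle `∞, c, c + 1, c - 1, c + 2, …, c + m` modulo `2m`. -/
def waleckiVal (m c x : ℕ) : ℕ := addPos m c (zigzag m (relPos m c x))

theorem waleckiVal_lt {m c x : ℕ} (hc : c < 2 * m) :
    waleckiVal m c x < 2 * m := by
  unfold waleckiVal addPos zigzag relPos
  split_ifs <;> omega

theorem relPos_spec (m c x : ℕ) :
    c ≤ x ∧ relPos m c x = x - c ∨ x < c ∧ relPos m c x = x + 2 * m - c := by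
  unfold relPos
  split_ifs <;> omega

theorem zigzag_spec (m t : ℕ) :
    t = 0 ∧ zigzag m t = 1 ∨ 0 < t ∧ t < m ∧ zigzag m t = 2 * m - t ∨
      0 < t ∧ m ≤ t ∧ zigzag m t = 2 * m + 1 - t := by
  unfold zigzag
  split_ifs <;> omega

theorem addPos_spec (m c u : ℕ) :
    u + c < 2 * m ∧ addPos m c u = u + c ∨ 2 * m ≤ u + c ∧ addPos m c u = u + c - 2 * m := by
  unfold addPos
  split_ifs <;> omega

/-- Away from m, the zigzag sends 0 to 1 and reflects the intervals (0, m) and (m, 2m) into the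
disjoint ranges (m, 2m) and [2, m]; translation by c preserves injectivity. -/
theorem waleckiVal_injective {m c x y : ℕ} (hc : c < 2 * m) (hx : x < 2 * m) (hy : y < 2 * m)
    (h : relPos m c x ≠ m) (h' : relPos m c y ≠ m)
    (e : waleckiVal m c x = waleckiVal m c y) : x = y := by
  unfold waleckiVal at e
  have hz : zigzag m (relPos m c x) = zigzag m (relPos m c y) := by
    have := zigzag_spec m (relPos m c x)
    have := zigzag_spec m (relPos m c y)
    have := relPos_spec m c x
    have := relPos_spec m c y
    rcases addPos_spec m c (zigzag m (relPos m c x)) with h1 | h1 <;>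
    rcases addPos_spec m c (zigzag m (relPos m c y)) with h2 | h2 <;> omega
  have ht : relPos m c x = relPos m c y := by
    have := relPos_spec m c x
    have := relPos_spec m c y
    rcases zigzag_spec m (relPos m c x) with h1 | h1 | h1 <;>
    rcases zigzag_spec m (relPos m c y) with h2 | h2 | h2 <;> omega
  rcases relPos_spec m c x with h1 | h1 <;> rcases relPos_spec m c y with h2 | h2 <;> omega

/-- An arc x → y of cycle c has x + y congruent to 2c or 2c + 1 modulo 2m, so the arc determines c
modulo m. Cycles c and c + m are reverses of each other: shifting the relative position of x by m
exchanges the two kinds of arc, which rules out a common one. -/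
theorem waleckiVal_disjoint {m c d x : ℕ} (hc : c < 2 * m) (hd : d < 2 * m) (hx : x < 2 * m)
    (h : relPos m c x ≠ m) (h' : relPos m d x ≠ m)
    (e : waleckiVal m c x = waleckiVal m d x) : c = d := by
  unfold waleckiVal at e
  generalize hy : addPos m d (zigzag m (relPos m d x)) = y at e
  rcases relPos_spec m c x with h1 | h1 <;> rcases relPos_spec m d x with h2 | h2 <;>
  rcases zigzag_spec m (relPos m c x) with h3 | h3 | h3 <;>
  rcases zigzag_spec m (relPos m d x) with h4 | h4 | h4 <;>
  rcases addPos_spec m c (zigzag m (relPos m c x)) with h5 | h5 <;>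
  rcases addPos_spec m d (zigzag m (relPos m d x)) with h6 | h6 <;> omega

/-- The zigzag never returns to 0, so c is entered only from ∞. -/
theorem waleckiVal_ne {m c x : ℕ} (hc : c < 2 * m) (hx : x < 2 * m)
    (h : relPos m c x ≠ m) : waleckiVal m c x ≠ c := by
  unfold waleckiVal addPos zigzag
  unfold relPos at *
  split_ifs at * <;> omega

/-- Walecki's Hamiltonian cycles of the complete digraph on `ℤ/2m` and one further vertex. -/
def walecki (m : ℕ) (c : Fin (2 * m)) : Option (Fin (2 * m)) → Option (Fin (2 * m))
  | none => some c
  | some x => if relPos m c x = m then none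
      else some ⟨waleckiVal m c x, waleckiVal_lt c.2⟩

theorem walecki_injective (m : ℕ) (c : Fin (2 * m)) : Injective (walecki m c) := by
  rintro (_ | x) (_ | y) e
  · rfl
  · simp only [walecki] at e
    split_ifs at e with h
    exact absurd (congrArg Fin.val (Option.some.inj e)).symm (waleckiVal_ne c.2 y.2 h)
  · simp only [walecki] at e
    split_ifs at e with h
    exact absurd (congrArg Fin.val (Option.some.inj e)) (waleckiVal_ne c.2 x.2 h)
  · simp only [walecki] at e
    have hx := x.2
    have hy := y.2
    have hc := c.2
    congr 1
    split_ifs at e with h h' h'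
    · unfold relPos at h h'
      ext
      split_ifs at h h' <;> omega
    · exact Fin.ext (waleckiVal_injective c.2 x.2 y.2 h h'
        (congrArg Fin.val (Option.some.inj e)))

theorem isHamiltonianFamily_walecki (m : ℕ) : IsHamiltonianFamily (walecki m) where
  strong c := by
    refine strong_of_rank (walecki_injective m c) none
      -- The rank is the number of steps left before ∞ is reached.
      (fun v => v.elim 0 fun x => if relPos m c x = 0 then 2 * m
        else if relPos m c x ≤ m then 2 * m + 1 - 2 * relPos m c x
        else 2 * relPos m c x - 2 * m) ?_
    rintro (_ | x) hx
    · exact absurd rfl hx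
    · have hx := x.2
      have hc := c.2
      simp only [walecki]
      split_ifs with h
      · simp only [Option.elim, h]
        split_ifs <;> omega
      · simp only [Option.elim]
        have hlt : relPos m c x < 2 * m := by unfold relPos; split_ifs <;> omega
        have hz : zigzag m (relPos m c x) < 2 * m := by unfold zigzag; split_ifs <;> omega
        have hrel : relPos m c (waleckiVal m c x) = zigzag m (relPos m c x) := by
          unfold waleckiVal
          generalize zigzag m (relPos m c x) = z at hz
          unfold relPos addPos
          split_ifs <;> omega
        rw [hrel]
        generalize relPos m c x = t at h hlt ⊢
        rcases zigzag_spec m t with h' | h' | h' <;> split_ifs <;> omega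
  disjoint := by
    rintro (_ | x) c d e
    · exact Option.some.inj e
    · simp only [walecki] at e
      have hx := x.2
      have hc := c.2
      have hd := d.2
      split_ifs at e with h h' h'
      · unfold relPos at h h'
        ext
        split_ifs at h h' <;> omega
      · exact Fin.ext (waleckiVal_disjoint c.2 d.2 x.2 h h'
          (congrArg Fin.val (Option.some.inj e)))


/-! ### Even order: a Hamiltonian path with one arc from each Walecki cycle -/

/-- The successors of the vertices `x ≠ 0, m + 1` in the cycle `rainbowOdd`. -/
def stepOdd (m x : ℕ) : ℕ := if x = 1 then 0 else if x = 2 then 2 * m - 2 else x - 2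

theorem stepOdd_spec (m x : ℕ) :
    x = 1 ∧ stepOdd m x = 0 ∨ x = 2 ∧ stepOdd m x = 2 * m - 2 ∨
      x ≠ 1 ∧ x ≠ 2 ∧ stepOdd m x = x - 2 := by
  unfold stepOdd
  split_ifs <;> omega

theorem stepOdd_lt {m x : ℕ} (hx : x < 2 * m) : stepOdd m x < 2 * m := by
  have := stepOdd_spec m x
  omega

/-- The successors of the vertices `x ≠ m + 1` in the cycle `rainbowEven`. -/
def stepEven (m x : ℕ) : ℕ :=
  if x = 0 then 2 * m - 1 else if x = m then m - 1 else stepOdd m x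

theorem stepEven_spec {m : ℕ} (hm : 3 ≤ m) (x : ℕ) :
    x = 0 ∧ stepEven m x = 2 * m - 1 ∨ x = m ∧ stepEven m x = m - 1 ∨
      x = 1 ∧ stepEven m x = 0 ∨ x = 2 ∧ stepEven m x = 2 * m - 2 ∨
      x ≠ 0 ∧ x ≠ m ∧ x ≠ 1 ∧ x ≠ 2 ∧ stepEven m x = x - 2 := by
  have := stepOdd_spec m x
  unfold stepEven
  split_ifs <;> omega

theorem stepEven_lt {m x : ℕ} (hm : 3 ≤ m) (hx : x < 2 * m) : stepEven m x < 2 * m := by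
  have := stepEven_spec hm x
  omega

/-- For odd `m`, the cycle `m - 1, m - 3, …, 2, 2m - 2, 2m - 4, …, m + 1, ∞, 2m - 1, 2m - 3, …, 1, 0`
and the new vertex `none`, where `∞` is `some none`. Apart from the arcs at the new vertex, it has
one arc of each of Walecki's cycles. -/
def rainbowOdd (m : ℕ) (hm : 3 ≤ m) :
    Option (Option (Fin (2 * m))) → Option (Option (Fin (2 * m)))
  | none => some (some ⟨m - 1, by omega⟩)
  | some none => some (some ⟨2 * m - 1, by omega⟩)
  | some (some x) => if (x : ℕ) = 0 then none else if (x : ℕ) = m + 1 then some none else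
      some (some ⟨stepOdd m x, stepOdd_lt x.2⟩)

/-- For even `m`, the cycle `m - 2, m - 4, …, 2, 2m - 2, 2m - 4, …, m, m - 1, m - 3, …, 1, 0,
2m - 1, 2m - 3, …, m + 1, ∞` and the new vertex `none`, where `∞` is `some none`. Apart from the
arcs at the new vertex, it has one arc of each of Walecki's cycles. -/
def rainbowEven (m : ℕ) (hm : 3 ≤ m) :
    Option (Option (Fin (2 * m))) → Option (Option (Fin (2 * m)))
  | none => some (some ⟨m - 2, by omega⟩)
  | some none => none
  | some (some x) => if (x : ℕ) = m + 1 then some none else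
      some (some ⟨stepEven m x, stepEven_lt hm x.2⟩)

theorem rainbowOdd_injective {m : ℕ} (hm : 3 ≤ m) (hodd : m % 2 = 1) :
    Injective (rainbowOdd m hm) := by
  rintro (_ | _ | x) (_ | _ | y) e <;> simp only [rainbowOdd] at e
  · rfl
  · simp only [Option.some.injEq, Fin.mk.injEq] at e
    omega
  · have := stepOdd_spec m y
    split_ifs at e <;> simp only [Option.some.injEq, Fin.mk.injEq, reduceCtorEq] at e
    omega
  · simp only [Option.some.injEq, Fin.mk.injEq] at e
    omega
  · rfl
  · have := stepOdd_spec m y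
    split_ifs at e <;> simp only [Option.some.injEq, Fin.mk.injEq, reduceCtorEq] at e
    omega
  · have := stepOdd_spec m x
    split_ifs at e <;> simp only [Option.some.injEq, Fin.mk.injEq, reduceCtorEq] at e
    omega
  · have := stepOdd_spec m x
    split_ifs at e <;> simp only [Option.some.injEq, Fin.mk.injEq, reduceCtorEq] at e
    omega
  · have hx := stepOdd_spec m x
    have hy := stepOdd_spec m y
    have := x.2
    have := y.2
    congr 2
    ext
    split_ifs at e <;>
      first | omega | (simp only [Option.some.injEq, Fin.mk.injEq, reduceCtorEq] at e <;> omega)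

theorem rainbowEven_injective {m : ℕ} (hm : 3 ≤ m) (heven : m % 2 = 0) :
    Injective (rainbowEven m hm) := by
  rintro (_ | _ | x) (_ | _ | y) e <;> simp only [rainbowEven, reduceCtorEq] at e
  · rfl
  · have := stepEven_spec hm y
    split_ifs at e <;> simp only [Option.some.injEq, Fin.mk.injEq, reduceCtorEq] at e
    omega
  · rfl
  · split_ifs at e
  · have := stepEven_spec hm x
    split_ifs at e <;> simp only [Option.some.injEq, Fin.mk.injEq, reduceCtorEq] at e
    omega
  · split_ifs at e
  · have hx := stepEven_spec hm x
    have hy := stepEven_spec hm y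
    have := x.2
    have := y.2
    congr 2
    ext
    split_ifs at e <;>
      first | omega | (simp only [Option.some.injEq, Fin.mk.injEq, reduceCtorEq] at e <;> omega)

theorem rainbowOdd_strong {m : ℕ} (hm : 3 ≤ m) (hodd : m % 2 = 1)
    (u v : Option (Option (Fin (2 * m)))) :
    ReflTransGen (fun a b => rainbowOdd m hm a = b) u v := by
  refine strong_of_rank (rainbowOdd_injective hm hodd) none
    -- The rank places the blocks in order along the cycle: even numbers below m, the other positive
    -- even numbers, ∞, odd numbers, 0. Only its decrease matters, not the exact distance.
    (fun v => v.elim 0 fun w => w.elim (2 * m + 1) fun x => if (x : ℕ) % 2 = 1 then x + 1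
      else if (x : ℕ) = 0 then 1 else if (x : ℕ) < m then 4 * m + x + 1 else 2 * m + x + 1) ?_ u v
  rintro (_ | _ | x) hx
  · exact absurd rfl hx
  · simp only [rainbowOdd, Option.elim]
    split_ifs <;> omega
  · have := x.2
    have := stepOdd_spec m x
    simp only [rainbowOdd]
    by_cases h0 : (x : ℕ) = 0
    · simp [h0]
    by_cases h1 : (x : ℕ) = m + 1
    · rw [if_neg h0, if_pos h1]
      simp only [Option.elim]
      split_ifs <;> omega
    rw [if_neg h0, if_neg h1]
    simp only [Option.elim]
    split_ifs <;> omega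

theorem rainbowEven_strong {m : ℕ} (hm : 3 ≤ m) (heven : m % 2 = 0)
    (u v : Option (Option (Fin (2 * m)))) :
    ReflTransGen (fun a b => rainbowEven m hm a = b) u v := by
  refine strong_of_rank (rainbowEven_injective hm heven) none
    -- The blocks are now: positive even numbers below m, even numbers from m on, odd numbers below
    -- m, 0, odd numbers above m, ∞.
    (fun v => v.elim 0 fun w => w.elim 1 fun x => if (x : ℕ) = 0 then 2 * m
      else if (x : ℕ) % 2 = 1 then if (x : ℕ) < m then 2 * m + x else x
      else if (x : ℕ) < m then 5 * m + x else 3 * m + x) ?_ u v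
  rintro (_ | _ | x) hx
  · exact absurd rfl hx
  · simp only [rainbowEven, Option.elim]
    omega
  · have := x.2
    have := stepEven_spec hm x
    simp only [rainbowEven]
    by_cases h1 : (x : ℕ) = m + 1
    · rw [if_pos h1]
      simp only [Option.elim]
      split_ifs <;> omega
    rw [if_neg h1]
    simp only [Option.elim]
    split_ifs <;> omega

/-- The representative of the tail of the common arc of `rainbowOdd` and `walecki m c`. -/
def tailOddVal (m c : ℕ) : ℕ :=
  if c = 0 then 2 else if c = 1 then m + 1 else if c = m then 1 else c + 1

theorem tailOddVal_spec (m c : ℕ) :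
    c = 0 ∧ tailOddVal m c = 2 ∨ c = 1 ∧ tailOddVal m c = m + 1 ∨
      1 < c ∧ c = m ∧ tailOddVal m c = 1 ∨ 1 < c ∧ c ≠ m ∧ tailOddVal m c = c + 1 := by
  unfold tailOddVal
  split_ifs <;> omega

/-- The representative of the tail of the common arc of `rainbowEven` and `walecki m c`. -/
def tailEvenVal (m c : ℕ) : ℕ :=
  if c + 1 = 2 * m then m else if c + 1 = m then 0 else tailOddVal m c

theorem tailEvenVal_spec {m : ℕ} (hm : 3 ≤ m) (c : ℕ) :
    c + 1 = 2 * m ∧ tailEvenVal m c = m ∨ c + 1 = m ∧ tailEvenVal m c = 0 ∨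
      c = 0 ∧ tailEvenVal m c = 2 ∨ c = 1 ∧ tailEvenVal m c = m + 1 ∨
      c = m ∧ tailEvenVal m c = 1 ∨
      1 < c ∧ c ≠ m ∧ c + 1 ≠ m ∧ c + 1 ≠ 2 * m ∧ tailEvenVal m c = c + 1 := by
  have := tailOddVal_spec m c
  unfold tailEvenVal
  split_ifs <;> omega

/-- The tail of the arc that `rainbowOdd` shares with the cycle `walecki m c`. -/
def tailOdd (m : ℕ) (hm : 3 ≤ m) (c : Fin (2 * m)) : Option (Fin (2 * m)) :=
  if h : c + 1 = 2 * m then none else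
    some ⟨tailOddVal m c, by have := c.2; have := tailOddVal_spec m c; omega⟩

/-- The tail of the arc that `rainbowEven` shares with the cycle `walecki m c`. -/
def tailEven (m : ℕ) (hm : 3 ≤ m) (c : Fin (2 * m)) : Option (Fin (2 * m)) :=
  some ⟨tailEvenVal m c, by have := c.2; have := tailEvenVal_spec hm c; omega⟩

theorem tailOdd_injective {m : ℕ} (hm : 3 ≤ m) : Injective (tailOdd m hm) := by
  intro c d e
  have := c.2
  have := d.2
  have hc := tailOddVal_spec m c
  have hd := tailOddVal_spec m d
  unfold tailOdd at e
  ext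
  split_ifs at e
  · omega
  · simp only [Option.some.injEq, Fin.mk.injEq] at e
    omega

theorem tailEven_injective {m : ℕ} (hm : 3 ≤ m) : Injective (tailEven m hm) := by
  intro c d e
  have := c.2
  have := d.2
  have hc := tailEvenVal_spec hm c
  have hd := tailEvenVal_spec hm d
  simp only [tailEven, Option.some.injEq, Fin.mk.injEq] at e
  ext
  omega

theorem walecki_some_eq_none {m : ℕ} {c x : Fin (2 * m)} (h : relPos m c x = m) :
    walecki m c (some x) = none := if_pos h

theorem walecki_some_eq_some {m : ℕ} {c x y : Fin (2 * m)} (h : relPos m c x ≠ m)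
    (h' : waleckiVal m c x = y) : walecki m c (some x) = some y :=
  (if_neg h).trans (congrArg some (Fin.ext h'))

/-- The generic shared arc is c + 1 → c - 1, from relative position 1 to -1. The exceptional cycles
0, 1, m and 2m - 1 supply 2 → 2m - 2, m + 1 → ∞, 1 → 0 and ∞ → 2m - 1, which join the runs of step
-2. -/
theorem rainbowOdd_tailOdd {m : ℕ} (hm : 3 ≤ m) (c : Fin (2 * m)) :
    rainbowOdd m hm (some (tailOdd m hm c)) = some (walecki m c (tailOdd m hm c)) := by
  have hc := c.2
  unfold tailOdd
  split_ifs with h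
  · simp only [rainbowOdd, walecki]
    congr 2
    ext
    dsimp only
    omega
  · generalize hx : (⟨_, _⟩ : Fin (2 * m)) = x
    have hx' := congrArg Fin.val hx
    dsimp only at hx'
    have ht := tailOddVal_spec m c
    have hr := relPos_spec m c x
    have hx0 : (x : ℕ) ≠ 0 := by omega
    by_cases hx1 : (x : ℕ) = m + 1
    · rw [walecki_some_eq_none (by omega)]
      simp only [rainbowOdd]
      rw [if_neg hx0, if_pos hx1]
    · simp only [rainbowOdd]
      rw [if_neg hx0, if_neg hx1, walecki_some_eq_some (by omega)]
      have hz := zigzag_spec m (relPos m c x)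
      have ha := addPos_spec m c (zigzag m (relPos m c x))
      have hs := stepOdd_spec m x
      unfold waleckiVal
      dsimp only
      omega

/-- Compared with odd m, cycle m - 1 now supplies 0 → 2m - 1 and cycle 2m - 1 supplies m → m - 1,
since ∞ ends the path. -/
theorem rainbowEven_tailEven {m : ℕ} (hm : 3 ≤ m) (c : Fin (2 * m)) :
    rainbowEven m hm (some (tailEven m hm c)) = some (walecki m c (tailEven m hm c)) := by
  have hc := c.2
  unfold tailEven
  generalize hx : (⟨_, _⟩ : Fin (2 * m)) = x
  have hx' := congrArg Fin.val hx
  dsimp only at hx'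
  have ht := tailEvenVal_spec hm c
  have hr := relPos_spec m c x
  by_cases hx1 : (x : ℕ) = m + 1
  · rw [walecki_some_eq_none (by omega)]
    simp only [rainbowEven]
    rw [if_pos hx1]
  · simp only [rainbowEven]
    rw [if_neg hx1, walecki_some_eq_some (by omega)]
    have hz := zigzag_spec m (relPos m c x)
    have ha := addPos_spec m c (zigzag m (relPos m c x))
    have hs := stepEven_spec hm x
    unfold waleckiVal
    dsimp only
    omega

theorem exists_tailOdd_eq {m : ℕ} (hm : 3 ≤ m) (v : Option (Fin (2 * m))) :
    rainbowOdd m hm (some v) = none ∨ ∃ c, tailOdd m hm c = v := by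
  rcases v with _ | x
  · exact .inr ⟨⟨2 * m - 1, by omega⟩, dif_pos (by dsimp only; omega)⟩
  · have hx := x.2
    by_cases h0 : (x : ℕ) = 0
    · exact .inl (by simp [rainbowOdd, h0])
    · obtain ⟨c, hc, hcx⟩ : ∃ c, c + 1 < 2 * m ∧ tailOddVal m c = x := by
        have h1 := tailOddVal_spec m 0
        have h2 := tailOddVal_spec m 1
        have h3 := tailOddVal_spec m m
        have h4 := tailOddVal_spec m (x - 1)
        by_cases x1 : (x : ℕ) = 1
        · exact ⟨m, by omega⟩
        by_cases x2 : (x : ℕ) = 2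
        · exact ⟨0, by omega⟩
        by_cases x3 : (x : ℕ) = m + 1
        · exact ⟨1, by omega⟩
        exact ⟨x - 1, by omega⟩
      refine .inr ⟨⟨c, by omega⟩, ?_⟩
      unfold tailOdd
      rw [dif_neg (by dsimp only; omega)]
      exact congrArg some (Fin.ext hcx)

theorem exists_tailEven_eq {m : ℕ} (hm : 3 ≤ m) (v : Option (Fin (2 * m))) :
    rainbowEven m hm (some v) = none ∨ ∃ c, tailEven m hm c = v := by
  rcases v with _ | x
  · exact .inl rfl
  · have hx := x.2
    obtain ⟨c, hc, hcx⟩ : ∃ c, c < 2 * m ∧ tailEvenVal m c = x := by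
      have h1 := tailEvenVal_spec hm 0
      have h2 := tailEvenVal_spec hm 1
      have h3 := tailEvenVal_spec hm m
      have h4 := tailEvenVal_spec hm (x - 1)
      have h5 := tailEvenVal_spec hm (m - 1)
      have h6 := tailEvenVal_spec hm (2 * m - 1)
      by_cases x0 : (x : ℕ) = 0
      · exact ⟨m - 1, by omega⟩
      by_cases x1 : (x : ℕ) = 1
      · exact ⟨m, by omega⟩
      by_cases x2 : (x : ℕ) = 2
      · exact ⟨0, by omega⟩
      by_cases x3 : (x : ℕ) = m + 1
      · exact ⟨1, by omega⟩
      by_cases x4 : (x : ℕ) = m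
      · exact ⟨2 * m - 1, by omega⟩
      exact ⟨x - 1, by omega⟩
    exact .inr ⟨⟨c, hc⟩, congrArg some (Fin.ext hcx)⟩

theorem exists_isHamiltonianFamily {k : ℕ} (hk : 2 ≤ k) (h4 : k ≠ 4) (h6 : k ≠ 6) :
    ∃ F : Fin (k - 1) → Fin k → Fin k, IsHamiltonianFamily F := by
  have of_card : ∀ {C V : Type} [Fintype C] [Fintype V] {F : C → V → V},
      IsHamiltonianFamily F → Fintype.card C = k - 1 → Fintype.card V = k →
      ∃ F : Fin (k - 1) → Fin k → Fin k, IsHamiltonianFamily F := fun hF hC hV =>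
    ⟨_, hF.transport (Fintype.equivFinOfCardEq hC).symm.toEmbedding
      (Fintype.equivFinOfCardEq hV)⟩
  rcases Nat.even_or_odd' k with ⟨m, rfl | rfl⟩
  · by_cases h1 : m = 1
    · subst h1
      exact ⟨fun _ v => v + 1, fun _ => strong_add_one 2, fun _ c d _ => Fin.ext (by omega)⟩
    -- Now k = 2m + 2: Walecki's 2m + 1 vertices and one new vertex. Excluding k = 2, 4, 6 is
    -- exactly m ≥ 3.
    obtain ⟨m, rfl⟩ : ∃ l, m = l + 1 := ⟨m - 1, by omega⟩
    have hm : 3 ≤ m := by omega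
    rcases Nat.mod_two_eq_zero_or_one m with h | h
    · obtain ⟨G, hG⟩ := (isHamiltonianFamily_walecki m).insert (tailEven_injective hm)
        (rainbowEven_injective hm h) (rainbowEven_strong hm h) (rainbowEven_tailEven hm)
        (exists_tailEven_eq hm)
      exact of_card hG (by simp; omega) (by simp; omega)
    · obtain ⟨G, hG⟩ := (isHamiltonianFamily_walecki m).insert (tailOdd_injective hm)
        (rainbowOdd_injective hm h) (rainbowOdd_strong hm h) (rainbowOdd_tailOdd hm)
        (exists_tailOdd_eq hm)
      exact of_card hG (by simp; omega) (by simp; omega)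
  · exact of_card (isHamiltonianFamily_walecki m) (by simp) (by simp)


/-! ### Exclusion of the orders 4 and 6 by search -/

/-- The list of the values at `0, …, k` of the cyclic permutation `0 → p₁ → p₂ → ⋯ → 0`. -/
def cycleRow (k : ℕ) (p : List ℕ) : List ℕ :=
  (List.range (k + 1)).map fun x => (p ++ [0]).getD ((0 :: p).idxOf x) 0

/-- The value lists of all Hamiltonian cycles on `0, …, k`. -/
def cycleRows (k : ℕ) : List (List ℕ) := ((List.range' 1 k).permutations').map (cycleRow k)

/-- Whether two lists of equal length differ at every position. -/
def differ : List ℕ → List ℕ → Bool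
  | a :: l, b :: l' => !(a.beq b) && differ l l'
  | _, _ => true

/-- Whether the list `r` has a smaller head than `s` and differs from it at every position. -/
def precedes (r s : List ℕ) : Bool := (r.headD 0).blt (s.headD 0) && differ r s

/-- Whether `L` contains `n` elements such that `R` relates each of them to all later ones. -/
def hasChain {α : Type*} (R : α → α → Bool) : ℕ → List α → Bool
  | 0, _ => true
  | n + 1, L => L.any fun r => hasChain R n (L.filter (R r))

theorem hasChain_of_pairwise {α : Type*} {R : α → α → Bool} {rs : List α}
    (hR : rs.Pairwise fun r s => R r s = true) {L : List α} (hL : ∀ r ∈ rs, r ∈ L) :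
    hasChain R rs.length L = true := by
  induction rs generalizing L with
  | nil => rfl
  | cons r rs ih =>
    rw [List.pairwise_cons] at hR
    refine List.any_eq_true.2 ⟨r, hL r List.mem_cons_self, ih hR.2 fun s hs => ?_⟩
    exact List.mem_filter.2 ⟨hL s (List.mem_cons_of_mem _ hs), hR.1 s hs⟩

theorem differ_map {α : Type*} {f g : α → ℕ} {l : List α} (h : ∀ x ∈ l, f x ≠ g x) :
    differ (l.map f) (l.map g) = true := by
  induction l with
  | nil => rfl
  | cons a l ih =>
    simp only [List.map_cons, differ, Bool.and_eq_true, Bool.not_eq_true']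
    exact ⟨Bool.eq_false_iff.2 (mt Nat.eq_of_beq_eq_true (h a List.mem_cons_self)),
      ih fun x hx => h x (List.mem_cons_of_mem _ hx)⟩

/-- A strong self-map visits all vertices once in a row. -/
theorem bijective_iterate {k : ℕ} {f : Fin (k + 1) → Fin (k + 1)}
    (hf : ∀ u v, ReflTransGen (fun a b => f a = b) u v) :
    Bijective (fun j : Fin (k + 1) => f^[j] 0) ∧ f^[k + 1] 0 = 0 := by
  have hsurj : Surjective f := by
    intro v
    by_cases h : f v = v
    · exact ⟨v, h⟩
    · rcases ReflTransGen.cases_tail (hf (f v) v) with h' | ⟨w, -, h'⟩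
      · exact absurd h'.symm h
      · exact ⟨w, h'⟩
  have hinj : Injective f := Finite.injective_iff_surjective.2 hsurj
  have hper := hinj.mem_periodicPts 0
  have hpos := minimalPeriod_pos_of_mem_periodicPts hper
  have hreach : Surjective (fun j : Fin (minimalPeriod f 0) => f^[j] 0) := by
    intro v
    obtain ⟨j, rfl⟩ := exists_iterate_eq (hf 0 v)
    exact ⟨⟨j % minimalPeriod f 0, Nat.mod_lt _ hpos⟩, iterate_mod_minimalPeriod_eq⟩
  have hinj' : Injective (fun j : Fin (minimalPeriod f 0) => f^[j] 0) := fun i j h =>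
    Fin.ext (iterate_injOn_Iio_minimalPeriod i.2 j.2 h)
  have hcard : minimalPeriod f 0 = k + 1 := by
    simpa using Fintype.card_of_bijective ⟨hinj', hreach⟩
  rw [hcard] at hinj' hreach
  exact ⟨⟨hinj', hreach⟩, by
    have := (isPeriodicPt_minimalPeriod f 0).eq
    rwa [hcard] at this⟩

/-- This makes the search exhaustive: the orbit of 0 with 0 removed is the permutation from which
the row is built. -/
theorem map_mem_cycleRows {k : ℕ} {f : Fin (k + 1) → Fin (k + 1)}
    (hf : ∀ u v, ReflTransGen (fun a b => f a = b) u v) :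
    (List.finRange (k + 1)).map (fun x => (f x : ℕ)) ∈ cycleRows k := by
  obtain ⟨hbij, hper⟩ := bijective_iterate hf
  let w : ℕ → ℕ := fun j => f^[j] 0
  have w_inj : ∀ i j, i ≤ k → j ≤ k → w i = w j → i = j := fun i j hi hj h =>
    congrArg Fin.val (@hbij.1 ⟨i, by omega⟩ ⟨j, by omega⟩ (Fin.ext h))
  refine List.mem_map.2 ⟨(List.range k).map fun j => w (j + 1), ?_, ?_⟩
  · rw [List.mem_permutations']
    refine (List.perm_ext_iff_of_nodup ?_ (List.nodup_range' ..)).2 fun a => ?_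
    · refine List.Nodup.map_on ?_ List.nodup_range
      intro i hi j hj h
      rw [List.mem_range] at hi hj
      have := w_inj _ _ (by omega) (by omega) h
      omega
    · rw [List.mem_map, List.mem_range'_1]
      constructor
      · rintro ⟨j, hj, rfl⟩
        rw [List.mem_range] at hj
        have h0 : w (j + 1) ≠ w 0 := fun h => by
          have := w_inj _ _ (by omega) (by omega) h
          omega
        have h1 : w (j + 1) < k + 1 := (f^[j + 1] 0).2
        have h2 : w 0 = 0 := rfl
        omega
      · rintro ⟨h1, h2⟩
        obtain ⟨⟨j, hj⟩, hja⟩ := hbij.2 ⟨a, by omega⟩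
        have hw : w j = a := congrArg Fin.val hja
        rcases j with _ | j
        · have h0 : w 0 = 0 := rfl
          omega
        · exact ⟨j, List.mem_range.2 (by omega), hw⟩
  · have hcons : 0 :: (List.range k).map (fun j => w (j + 1)) = (List.range (k + 1)).map w := by
      rw [List.range_succ_eq_map, List.map_cons, List.map_map]
      rfl
    have hsnoc : (List.range k).map (fun j => w (j + 1)) ++ [0] =
        (List.range (k + 1)).map fun j => w (j + 1) := by
      have h0 : w (k + 1) = 0 := congrArg Fin.val hper
      rw [List.range_succ, List.map_append, List.map_singleton, h0]
    unfold cycleRow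
    rw [hcons, hsnoc, ← List.map_coe_finRange_eq_range, List.map_map]
    refine List.map_congr_left fun x _ => ?_
    obtain ⟨⟨j, hj⟩, rfl⟩ := hbij.2 x
    have hidx : ((List.range (k + 1)).map w).idxOf (w j) = j := by
      have hnd : ((List.range (k + 1)).map w).Nodup := by
        refine List.Nodup.map_on ?_ List.nodup_range
        intro i hi j hj h
        rw [List.mem_range] at hi hj
        exact w_inj _ _ (by omega) (by omega) h
      have := hnd.idxOf_getElem j (by simpa using hj)
      simpa using this
    rw [List.map_coe_finRange_eq_range, comp_apply]
    show List.getD _ (List.idxOf (w j) _) 0 = _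
    rw [hidx, List.getD_eq_getElem _ _ (by simpa using hj)]
    simp [w, iterate_succ_apply']

/-- The k successors of 0 are distinct and nonzero, so each nonzero vertex occurs once among them.
Sorting the cycles by this successor gives the chain, and the search need only consider one order of
each family. -/
theorem hasChain_of_isHamiltonianFamily {k : ℕ} (hk : 1 ≤ k)
    {F : Fin k → Fin (k + 1) → Fin (k + 1)} (hF : IsHamiltonianFamily F) :
    hasChain precedes k (cycleRows k) = true := by
  have h0 : ∀ i, F i 0 ≠ 0 := by
    intro i h
    have : ∀ v, ReflTransGen (fun a b => F i a = b) 0 v → v = 0 := by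
      intro v hv
      induction hv with
      | refl => rfl
      | tail _ h' ih => rw [← h', ih, h]
    have := congrArg Fin.val (this (Fin.last k) (hF.strong i _ _))
    simp at this
    omega
  have hinj : Injective fun i => (F i 0).pred (h0 i) := fun i j h =>
    hF.disjoint 0 (Fin.pred_inj.1 h)
  have hsurj := Finite.injective_iff_surjective.1 hinj
  choose idx hidx using hsurj
  have hhead : ∀ j, F (idx j) 0 = j.succ := fun j => by rw [← hidx j, Fin.succ_pred]; simp [hidx]
  let row : Fin k → List ℕ := fun j => (List.finRange (k + 1)).map fun x => (F (idx j) x : ℕ)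
  have hrow : ∀ j, (row j).headD 0 = j + 1 := by
    intro j
    simp [row, List.finRange_succ, hhead]
  have := hasChain_of_pairwise (R := precedes) (rs := (List.finRange k).map row)
    (L := cycleRows k) ?_ ?_
  · simpa using this
  · rw [List.pairwise_map]
    refine (List.pairwise_lt_finRange k).imp fun {i j} hij => ?_
    unfold precedes
    rw [Bool.and_eq_true, hrow, hrow]
    refine ⟨of_eq_true (by rw [Nat.blt_eq]; exact eq_true (by omega)), differ_map fun x _ h => ?_⟩
    have h' : idx i = idx j := hF.disjoint x (Fin.ext h)
    have h'' := congrArg (fun t => F t 0) h'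
    simp only [hhead, Fin.succ_inj] at h''
    exact hij.ne h''
  · intro r hr
    obtain ⟨j, -, rfl⟩ := List.mem_map.1 hr
    exact map_mem_cycleRows (hF.strong _)

theorem not_isHamiltonianFamily_four (F : Fin 3 → Fin 4 → Fin 4) : ¬ IsHamiltonianFamily F :=
  fun hF => by
    have h : hasChain precedes 3 (cycleRows 3) = false := by decide +kernel
    exact Bool.false_ne_true (h ▸ hasChain_of_isHamiltonianFamily (by omega) hF)

theorem not_isHamiltonianFamily_six (F : Fin 5 → Fin 6 → Fin 6) : ¬ IsHamiltonianFamily F :=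
  fun hF => by
    have h : hasChain precedes 5 (cycleRows 5) = false := by decide +kernel
    exact Bool.false_ne_true (h ▸ hasChain_of_isHamiltonianFamily (by omega) hF)


/-! ### Bounds by out-degrees -/

section Bounds

variable {V : Type*} {D : Digraph V} {S : Finset V}

theorem exists_adj_of_mem {p : ℕ} {H : Fin p → Subdigraph D}
    (hH : IsInternallyDisjointFamily S H) (hS : 2 ≤ S.card) {s : V} (hs : s ∈ S) (i : Fin p) :
    ∃ t, (H i).Adj s t := by
  obtain ⟨t, ht, hts⟩ := Finset.exists_mem_ne (by omega : 1 < S.card) s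
  rcases ReflTransGen.cases_head
    (hH.strong i s (hH.subset i hs) t (hH.subset i ht)) with h | ⟨w, hw, -⟩
  · exact absurd h.symm hts
  · exact ⟨w, hw⟩

theorem le_ncard_out [Finite V] {p : ℕ} {H : Fin p → Subdigraph D}
    (hH : IsInternallyDisjointFamily S H) (hS : 2 ≤ S.card) {s : V} (hs : s ∈ S) :
    p ≤ {t | D.Adj s t}.ncard := by
  choose t ht using exists_adj_of_mem hH hS hs
  have hinj : Injective fun i => (⟨t i, (H i).adj_sub (ht i)⟩ : {t | D.Adj s t}) := by
    intro i j hij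
    by_contra hne
    have hij' : t i = t j := congrArg Subtype.val hij
    exact hH.arc_disjoint i j hne s (t i) ⟨ht i, hij' ▸ ht j⟩
  have := Nat.card_le_card_of_injective _ hinj
  rwa [Nat.card_fin, Nat.card_coe_set_eq] at this

theorem kappaSet_le_ncard_out [Finite V] (hS : 2 ≤ S.card) {s : V} (hs : s ∈ S) :
    kappaSet D S ≤ ({t | D.Adj s t}.ncard : ℕ∞) :=
  iSup₂_le fun _ ⟨_, hH⟩ => by exact_mod_cast le_ncard_out hH hS hs

theorem le_kappaSet {p : ℕ} {H : Fin p → Subdigraph D} (hH : IsInternallyDisjointFamily S H) :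
    (p : ℕ∞) ≤ kappaSet D S :=
  le_iSup₂_of_le (f := fun (p : ℕ) (_ : ∃ H : Fin p → Subdigraph D,
    IsInternallyDisjointFamily S H) => (p : ℕ∞)) p ⟨H, hH⟩ le_rfl

/-- If all families had fewer than p members, p - 1 would bound the supremum; p ≥ 1 makes the
truncated p - 1 smaller than p. -/
theorem exists_family_of_le_kappaSet {p : ℕ} (hp : 1 ≤ p) (h : (p : ℕ∞) ≤ kappaSet D S) :
    ∃ q, p ≤ q ∧ ∃ H : Fin q → Subdigraph D, IsInternallyDisjointFamily S H := by
  by_contra hcon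
  push Not at hcon
  have : kappaSet D S ≤ ((p - 1 : ℕ) : ℕ∞) := by
    refine iSup₂_le fun q ⟨H, hH⟩ => ?_
    have : ¬ p ≤ q := fun hpq => hcon q hpq H hH
    exact_mod_cast (by omega : q ≤ p - 1)
  have := h.trans this
  have : p ≤ p - 1 := by exact_mod_cast this
  omega

theorem ncard_out_le [Fintype V] (hD : IsLoopless D) (s : V) :
    {t | D.Adj s t}.ncard ≤ Fintype.card V - 1 := by
  have hsub : {t | D.Adj s t} ⊆ {s}ᶜ := fun t ht h => hD s (by rwa [h] at ht)
  refine (Set.ncard_le_ncard hsub).trans ?_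
  rw [Set.ncard_compl, Set.ncard_singleton, Nat.card_eq_fintype_card]

theorem ncard_out_le_of_not_adj [Fintype V] (hD : IsLoopless D) {u v : V} (huv : u ≠ v)
    (h : ¬ D.Adj u v) : {t | D.Adj u t}.ncard ≤ Fintype.card V - 2 := by
  have hsub : {t | D.Adj u t} ⊆ {u, v}ᶜ := by
    rintro t ht (rfl | rfl)
    · exact hD _ ht
    · exact h ht
  refine (Set.ncard_le_ncard hsub).trans ?_
  rw [Set.ncard_compl, Set.ncard_pair huv, Nat.card_eq_fintype_card]

theorem one_le_kappaSet (hD : IsStrong D) : 1 ≤ kappaSet D S := by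
  let H : Fin 1 → Subdigraph D := fun _ =>
    { verts := Set.univ, Adj := D.Adj, adj_sub := id, tail_mem := fun _ => trivial,
      head_mem := fun _ => trivial }
  exact le_kappaSet (H := H)
    { strong := fun _ u _ v _ => hD u v
      subset := fun _ => Set.subset_univ _
      inter_verts := fun i j h => absurd (Subsingleton.elim i j) h
      arc_disjoint := fun i j h => absurd (Subsingleton.elim i j) h }

theorem exists_card_eq_mem [Fintype V] {k : ℕ} (hk : 1 ≤ k) (hkn : k ≤ Fintype.card V) (s : V) :
    ∃ S : Finset V, S.card = k ∧ s ∈ S := by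
  obtain ⟨S, hS, -, hc⟩ := Finset.exists_subsuperset_card_eq (Finset.subset_univ {s})
    (by simpa using hk) (by simpa using hkn)
  exact ⟨S, hc, Finset.singleton_subset_iff.1 hS⟩

theorem kappa_le_ncard_out [Fintype V] {k : ℕ} (hk : 2 ≤ k) (hkn : k ≤ Fintype.card V) (s : V) :
    kappa k D ≤ ({t | D.Adj s t}.ncard : ℕ∞) := by
  obtain ⟨S, hc, hs⟩ := exists_card_eq_mem (by omega) hkn s
  exact (iInf₂_le S hc).trans (kappaSet_le_ncard_out (by omega) hs)

theorem one_le_kappa (hD : IsStrong D) (k : ℕ) : 1 ≤ kappa k D :=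
  le_iInf₂ fun _ _ => one_le_kappaSet hD

end Bounds

/-! ### Families of maximal size and Hamiltonian cycles on S -/

/-- In a family of `|V| - 1` internally disjoint strong subgraphs, those on the vertex set `S`
are Hamiltonian cycles on `S`, and there are at least `|S| - 1` of them. -/
theorem exists_isHamiltonianFamily_of_family {V : Type*} [Fintype V] {D : Digraph V}
    (hD : IsLoopless D) {S : Finset V} {k : ℕ} (hk : 2 ≤ k) (hS : S.card = k)
    {H : Fin (Fintype.card V - 1) → Subdigraph D} (hH : IsInternallyDisjointFamily S H) :
    ∃ F : Fin (k - 1) → Fin k → Fin k, IsHamiltonianFamily F := by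
  classical
  have hn : k ≤ Fintype.card V := hS ▸ Finset.card_le_univ S
  have hS2 : 2 ≤ S.card := hS ▸ hk
  have out : ∀ (i) (s : S), ∃ t, (H i).Adj s t := fun i s => exists_adj_of_mem hH hS2 s.2 i
  choose t ht using out
  have t_inj : ∀ s, Injective fun i => t i s := by
    intro s i j hij
    by_contra hne
    have hij' : t i s = t j s := hij
    exact hH.arc_disjoint i j hne s (t i s) ⟨ht i s, hij' ▸ ht j s⟩
  -- The chosen arcs out of s already reach every other vertex. A second out-arc in one subgraph
  -- would therefore be the chosen arc of another.
  have adj_iff : ∀ i (s : S) v, (H i).Adj s v ↔ t i s = v := by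
    intro i s v
    refine ⟨fun h => ?_, fun h => h ▸ ht i s⟩
    have hne : ∀ i v, (H i).Adj s v → v ≠ s := fun i v h hv => hD s ((H i).adj_sub (hv ▸ h))
    let f : Fin (Fintype.card V - 1) → {v : V // v ≠ s} := fun j => ⟨t j s, hne j _ (ht j s)⟩
    have hf : Injective f := fun i j h => t_inj s (congrArg Subtype.val h)
    have hb : Bijective f := (Fintype.bijective_iff_injective_and_card f).2
      ⟨hf, by simp [Fintype.card_subtype_compl]⟩
    obtain ⟨j, hj⟩ := hb.2 ⟨v, hne i v h⟩
    have hj' : t j s = v := congrArg Subtype.val hj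
    by_cases hij : i = j
    · rw [hij, hj']
    · exact absurd ⟨h, hj' ▸ ht j s⟩ (hH.arc_disjoint i j hij s v)
  let I := {i // (H i).verts = (S : Set V)}
  -- Each subgraph outside I has a vertex outside S that no other subgraph contains. There are at
  -- most n - k of these, which leaves (n - 1) - (n - k) = k - 1.
  have hI : k - 1 ≤ Fintype.card I := by
    have hex : ∀ i : {i // ¬ (H i).verts = (S : Set V)}, ∃ w, w ∈ (H i).verts ∧ w ∉ S := by
      rintro ⟨i, hi⟩
      by_contra hcon
      push Not at hcon
      exact hi (Set.Subset.antisymm hcon (hH.subset i))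
    choose w hw hwS using hex
    have hwinj : Injective fun i => (⟨w i, hwS i⟩ : {v // v ∉ S}) := by
      intro i j hij
      by_contra hne
      have hij' : w i = w j := congrArg Subtype.val hij
      have : w i ∈ (H i).verts ∩ (H j).verts := ⟨hw i, hij' ▸ hw j⟩
      rw [hH.inter_verts i j fun h => hne (Subtype.ext h)] at this
      exact hwS i this
    have h1 := Fintype.card_le_of_injective _ hwinj
    rw [Fintype.card_subtype_compl, Fintype.card_subtype_compl, Fintype.card_fin,
      Fintype.card_coe, hS] at h1
    have h2 : Fintype.card I ≤ Fintype.card V - 1 := by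
      simpa using Fintype.card_subtype_le fun i => (H i).verts = (S : Set V)
    change Fintype.card V - 1 - Fintype.card I ≤ _ at h1
    omega
  have t_mem : ∀ (i : I) s, t i s ∈ S := by
    rintro ⟨i, hi⟩ s
    have := (H i).head_mem (ht i s)
    rwa [hi] at this
  have hF : IsHamiltonianFamily fun (i : I) (s : S) => (⟨t i s, t_mem i s⟩ : S) := by
    refine ⟨fun i u v => ?_, fun s i j h => Subtype.ext (t_inj s (congrArg Subtype.val h))⟩
    have walk := hH.strong i u (hH.subset i u.2) v (hH.subset i v.2)
    have : ∀ w : V, ReflTransGen (H i).Adj u w → ∃ hw : w ∈ S,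
        ReflTransGen (fun a b => (⟨t i a, t_mem i a⟩ : S) = b) u ⟨w, hw⟩ := by
      intro w hw
      induction hw with
      | refl => exact ⟨u.2, .refl⟩
      | @tail b c _ hbc ih =>
        obtain ⟨hb, ih⟩ := ih
        have hbc' := (adj_iff i ⟨b, hb⟩ c).1 hbc
        subst hbc'
        exact ⟨t_mem i _, ih.tail rfl⟩
    exact (this v walk).2
  obtain ⟨e⟩ := Function.Embedding.nonempty_of_card_le
    (α := Fin (k - 1)) (β := I) (by simpa using hI)
  exact ⟨_, hF.transport e (Fintype.equivFinOfCardEq (by simpa using hS))⟩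

/-- In a complete digraph, `|S| - 1` arc-disjoint Hamiltonian cycles on `S` and, for each vertex
`w` outside `S`, the star of all arcs between `w` and `S`. -/
theorem le_kappaSet_of_isHamiltonianFamily {V : Type*} [Fintype V] {D : Digraph V}
    (hD : ∀ u v, D.Adj u v ↔ u ≠ v) {S : Finset V} {k : ℕ} (hk : 2 ≤ k) (hS : S.card = k)
    {F : Fin (k - 1) → Fin k → Fin k} (hF : IsHamiltonianFamily F) :
    ((Fintype.card V - 1 : ℕ) : ℕ∞) ≤ kappaSet D S := by
  classical
  have hn : k ≤ Fintype.card V := hS ▸ Finset.card_le_univ S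
  obtain ⟨G, hG⟩ : ∃ G : Fin (k - 1) → S → S, IsHamiltonianFamily G :=
    ⟨_, hF.transport (.refl _) (Fintype.equivFinOfCardEq (by simpa using hS)).symm⟩
  -- A fixed point could not reach the second vertex of S; hence no cycle uses a loop.
  have hGne : ∀ i s, G i s ≠ s := by
    intro i s h
    obtain ⟨t, ht, hts⟩ := Finset.exists_mem_ne (by omega : 1 < S.card) s
    obtain ⟨j, hj⟩ := exists_iterate_eq (hG.strong i s ⟨t, ht⟩)
    rw [iterate_fixed h] at hj
    exact hts (congrArg Subtype.val hj).symm
  let K : Fin (k - 1) ⊕ {w // w ∉ S} → Subdigraph D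
    | .inl i =>
      { verts := S
        Adj := fun u v => ∃ s : S, u = s ∧ v = G i s
        adj_sub := by
          rintro u v ⟨s, rfl, rfl⟩
          exact (hD _ _).2 fun h => hGne i s (Subtype.ext h.symm)
        tail_mem := by
          rintro u v ⟨s, rfl, rfl⟩
          exact s.2
        head_mem := by
          rintro u v ⟨s, rfl, rfl⟩
          exact (G i s).2 }
    | .inr w =>
      { verts := insert w.1 (S : Set V)
        Adj := fun u v => u = w ∧ v ∈ S ∨ u ∈ S ∧ v = w
        adj_sub := by
          rintro u v (⟨rfl, h⟩ | ⟨h, rfl⟩)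
          · exact (hD _ _).2 fun h' => w.2 (h' ▸ h)
          · exact (hD _ _).2 fun h' => w.2 (h' ▸ h)
        tail_mem := by
          rintro u v (⟨rfl, h⟩ | ⟨h, rfl⟩)
          · exact .inl rfl
          · exact .inr h
        head_mem := by
          rintro u v (⟨rfl, h⟩ | ⟨h, rfl⟩)
          · exact .inr h
          · exact .inl rfl }
  have hcard : Fintype.card (Fin (k - 1) ⊕ {w // w ∉ S}) = Fintype.card V - 1 := by
    rw [Fintype.card_sum, Fintype.card_fin, Fintype.card_subtype_compl, Fintype.card_coe, hS]
    omega
  let e := (Fintype.equivFinOfCardEq hcard).symm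
  have hstrong : ∀ x, (K x).IsStrong := by
    rintro (i | w) u hu v hv
    · exact ReflTransGen.lift (p := (K (.inl i)).Adj) (Subtype.val : S → V)
        (by rintro a b rfl; exact ⟨a, rfl, rfl⟩) _ _ (hG.strong i ⟨u, hu⟩ ⟨v, hv⟩)
    · have to_center : ReflTransGen (K (.inr w)).Adj u w := by
        rcases hu with rfl | hu
        · exact .refl
        · exact .single (.inr ⟨hu, rfl⟩)
      refine to_center.trans ?_
      rcases hv with rfl | hv
      · exact .refl
      · exact .single (.inl ⟨rfl, hv⟩)
  have hsub : ∀ x, (S : Set V) ⊆ (K x).verts := by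
    rintro (i | w)
    · exact Set.Subset.rfl
    · exact Set.subset_insert _ _
  have hinter : ∀ x y, x ≠ y → (K x).verts ∩ (K y).verts ⊆ (S : Set V) := by
    rintro (i | w) (j | z) hxy v ⟨h1, h2⟩
    · exact h1
    · exact h1
    · exact h2
    · rcases h1 with rfl | h1
      · rcases h2 with h2 | h2
        · exact absurd (congrArg Sum.inr (Subtype.ext h2)) hxy
        · exact h2
      · exact h1
  have harc : ∀ x y, x ≠ y → ∀ u v, ¬ ((K x).Adj u v ∧ (K y).Adj u v) := by
    rintro (i | w) (j | z) hxy u v ⟨h1, h2⟩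
    · obtain ⟨s, rfl, rfl⟩ := h1
      obtain ⟨s', h, h'⟩ := h2
      obtain rfl := Subtype.ext h
      exact hxy (congrArg Sum.inl (hG.disjoint s (Subtype.ext h')))
    · have hu := (K (.inl i)).tail_mem h1
      have hv := (K (.inl i)).head_mem h1
      rcases h2 with ⟨rfl, -⟩ | ⟨-, rfl⟩
      · exact z.2 hu
      · exact z.2 hv
    · have hu := (K (.inl j)).tail_mem h2
      have hv := (K (.inl j)).head_mem h2
      rcases h1 with ⟨rfl, -⟩ | ⟨-, rfl⟩
      · exact w.2 hu
      · exact w.2 hv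
    · have hwz : w.1 ≠ z.1 := fun h => hxy (congrArg Sum.inr (Subtype.ext h))
      rcases h1 with ⟨rfl, h⟩ | ⟨h, rfl⟩ <;> rcases h2 with ⟨h3, h4⟩ | ⟨h3, h4⟩
      · exact hwz h3
      · exact w.2 h3
      · exact w.2 h4
      · exact hwz h4
  refine le_kappaSet (H := fun i => K (e i))
    { strong := fun i => hstrong _
      subset := fun i => hsub _
      inter_verts := fun i j hij => Set.Subset.antisymm
        (hinter _ _ fun h => hij (e.injective h)) (Set.subset_inter (hsub _) (hsub _))
      arc_disjoint := fun i j hij => harc _ _ fun h => hij (e.injective h) }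

/-! ### The characterization and sharpness -/

theorem kappa_eq_iff {V : Type*} [Fintype V] {D : Digraph V} (hD : IsLoopless D) {k : ℕ}
    (hk : 2 ≤ k) (hkn : k ≤ Fintype.card V) :
    kappa k D = ((Fintype.card V - 1 : ℕ) : ℕ∞) ↔
      (∀ u v, D.Adj u v ↔ u ≠ v) ∧ k ≠ 4 ∧ k ≠ 6 := by
  constructor
  · intro h
    -- A single k-set S suffices, since the existence of the cycles depends on k alone.
    have hne : ∃ F : Fin (k - 1) → Fin k → Fin k, IsHamiltonianFamily F := by
      obtain ⟨S, -, hS⟩ := Finset.exists_subset_card_eq (s := (Finset.univ : Finset V)) hkn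
      obtain ⟨q, hq, H, hH⟩ := exists_family_of_le_kappaSet (D := D) (S := S)
        (p := Fintype.card V - 1) (by omega) (h ▸ iInf₂_le S hS)
      obtain ⟨s, hs⟩ : S.Nonempty := Finset.card_pos.1 (by omega)
      obtain rfl : q = Fintype.card V - 1 :=
        le_antisymm ((le_ncard_out hH (by omega) hs).trans (ncard_out_le hD s)) hq
      exact exists_isHamiltonianFamily_of_family hD hk hS hH
    refine ⟨fun u v => ⟨fun huv e => hD u (e ▸ huv), fun huv => ?_⟩, ?_, ?_⟩
    · by_contra hcon
      have h1 := kappa_le_ncard_out (D := D) hk hkn u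
      rw [h] at h1
      have h2 : Fintype.card V - 1 ≤ {t | D.Adj u t}.ncard := by exact_mod_cast h1
      have h3 := ncard_out_le_of_not_adj hD huv hcon
      omega
    · rintro rfl
      obtain ⟨F, hF⟩ := hne
      exact not_isHamiltonianFamily_four F hF
    · rintro rfl
      obtain ⟨F, hF⟩ := hne
      exact not_isHamiltonianFamily_six F hF
  · rintro ⟨hadj, h4, h6⟩
    obtain ⟨F, hF⟩ := exists_isHamiltonianFamily hk h4 h6
    refine le_antisymm ?_ (le_iInf₂ fun S hS => le_kappaSet_of_isHamiltonianFamily hadj hk hS hF)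
    obtain ⟨v⟩ : Nonempty V := Fintype.card_pos_iff.1 (by omega)
    exact (kappa_le_ncard_out hk hkn v).trans (by exact_mod_cast ncard_out_le hD v)

theorem isIsomorphic_complete_iff {V : Type*} [Fintype V] {D : Digraph V} {n : ℕ}
    (hn : Fintype.card V = n) :
    IsIsomorphic D (biorientation (⊤ : SimpleGraph (Fin n))) ↔ ∀ u v, D.Adj u v ↔ u ≠ v := by
  constructor
  · rintro ⟨e⟩ u v
    rw [← e.map_rel_iff, ← e.injective.ne_iff]
    rfl
  · intro h
    refine ⟨⟨Fintype.equivFinOfCardEq hn, ?_⟩⟩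
    intro u v
    rw [h]
    simp [biorientation]

/-- The directed n-cycle is strong and has out-degree one. -/
theorem exists_kappa_eq_one {n k : ℕ} (hk : 2 ≤ k) (hkn : k ≤ n) :
    ∃ D : Digraph (Fin n), IsLoopless D ∧ IsStrong D ∧ kappa k D = 1 := by
  have : NeZero n := ⟨by omega⟩
  let D : Digraph (Fin n) := ⟨fun a b => a + 1 = b⟩
  have hs : IsStrong D := strong_add_one n
  refine ⟨D, ?_, hs, le_antisymm ?_ (one_le_kappa hs k)⟩
  · intro v h
    have h' : v + 1 = v := h
    rw [add_eq_left] at h'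
    have := congrArg Fin.val h'
    rw [Fin.val_one', Fin.val_zero, Nat.mod_eq_of_lt (by omega)] at this
    omega
  · have h := kappa_le_ncard_out (D := D) hk (by simpa using hkn) 0
    have h1 : {t | D.Adj 0 t} = {0 + 1} := by
      ext t
      exact eq_comm
    rw [h1, Set.ncard_singleton] at h
    exact_mod_cast h

theorem bounds_and_characterization {n k : ℕ} (hk : 2 ≤ k) (hkn : k ≤ n) (V : Type*) [Fintype V]
    (D : Digraph V) (hn : Fintype.card V = n) (hD : IsLoopless D) (hs : IsStrong D) :
    (1 ≤ kappa k D ∧ kappa k D ≤ ((n - 1 : ℕ) : ℕ∞)) ∧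
      (kappa k D = ((n - 1 : ℕ) : ℕ∞) ↔
        IsIsomorphic D (biorientation (⊤ : SimpleGraph (Fin n))) ∧ k ≠ 4 ∧ k ≠ 6) := by
  rw [isIsomorphic_complete_iff hn]
  subst hn
  obtain ⟨v⟩ : Nonempty V := Fintype.card_pos_iff.1 (by omega)
  exact ⟨⟨one_le_kappa hs k,
    (kappa_le_ncard_out hk hkn v).trans (by exact_mod_cast ncard_out_le hD v)⟩,
    kappa_eq_iff hD hk hkn⟩

end StrongSubgraph

theorem theorem2 (n k : ℕ) (hk : 2 ≤ k) (hkn : k ≤ n) :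
    -- the bounds and the characterization of the upper bound
    (∀ (V : Type*) [Fintype V] (D : Digraph V), Fintype.card V = n →
      StrongSubgraph.IsLoopless D → StrongSubgraph.IsStrong D →
        (1 ≤ StrongSubgraph.kappa k D ∧
          StrongSubgraph.kappa k D ≤ ((n - 1 : ℕ) : ℕ∞)) ∧
        (StrongSubgraph.kappa k D = ((n - 1 : ℕ) : ℕ∞) ↔
          StrongSubgraph.IsIsomorphic D
            (StrongSubgraph.biorientation (⊤ : SimpleGraph (Fin n))) ∧
          k ≠ 4 ∧ k ≠ 6)) ∧
    -- the lower bound is sharp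
    (∃ D : Digraph (Fin n), StrongSubgraph.IsLoopless D ∧ StrongSubgraph.IsStrong D ∧
      StrongSubgraph.kappa k D = 1) ∧
    -- the upper bound is sharp
    (k ≠ 4 → k ≠ 6 → ∃ D : Digraph (Fin n),
      StrongSubgraph.IsLoopless D ∧ StrongSubgraph.IsStrong D ∧
      StrongSubgraph.kappa k D = ((n - 1 : ℕ) : ℕ∞)) := by
  refine ⟨fun V _ D hn hD hs => StrongSubgraph.bounds_and_characterization hk hkn V D hn hD hs,
    StrongSubgraph.exists_kappa_eq_one hk hkn, fun h4 h6 => ?_⟩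
  have hadj : ∀ u v, (StrongSubgraph.biorientation (⊤ : SimpleGraph (Fin n))).Adj u v ↔ u ≠ v :=
    fun u v => by simp [StrongSubgraph.biorientation]
  have hloop : StrongSubgraph.IsLoopless
      (StrongSubgraph.biorientation (⊤ : SimpleGraph (Fin n))) :=
    fun v h => (hadj v v).1 h rfl
  refine ⟨_, hloop, fun u v => ?_, ?_⟩
  · by_cases h : u = v
    · exact h ▸ .refl
    · exact .single ((hadj u v).2 h)
  · have := (StrongSubgraph.kappa_eq_iff hloop hk (by simpa using hkn)).2 ⟨hadj, h4, h6⟩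
    simpa using this
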